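/- Let $m,n$ be integers with $m\ge 0$, $n\ge 0$, let $\Omega\subseteq\mathbb{R}^m$ be an open set, and let $f=(f^1,\dots,f^{2n+1})\in W^{1,1}_{\mathrm{loc}}(\Omega,\mathbb{R}^{2n+1})$, that is, $f$ is locally integrable in $\Omega$ and its first-order distributional partial derivatives are represented by locally integrable functions in $\Omega$. Let $Df(x)=\bigl(\frac{\partial f^k}{\partial x_i}(x)\bigr)_{1\le k\le 2n+1,\,1\le i\le m}$ be (any version of) the Jacobian matrix formed by these weak partial derivatives, and let $df^k=\sum_{i=1}^m\frac{\partial f^k}{\partial x_i}\,dx_i$. Suppose that the contact equation \[ df^{2n+1}=\sum_{j=1}^n\bigl(f^j\,df^{j+n}-f^{j+n}\,df^j\bigr) \] holds at almost every point of $\Omega$ (with respect to Lebesgue measure). Then the $(2n+1)\times m$ matrix $Df(x)$ has rank at most $n$ for almost every $x\in\Omega$. -/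

import Mathlib

open MeasureTheory
open scoped ContDiff

/-- `g` is the weak partial derivative `∂u/∂xᵢ` of the real function `u` in the open set `Ω ⊆ ℝᵐ`:
it is locally integrable in `Ω` and integration by parts holds against every test function
`φ ∈ C_c^∞(Ω)`. -/
def IsWeakPartialDeriv {m : ℕ} (Ω : Set (EuclideanSpace ℝ (Fin m))) (i : Fin m)
    (u g : EuclideanSpace ℝ (Fin m) → ℝ) : Prop :=
  LocallyIntegrableOn g Ω volume ∧
    ∀ φ : EuclideanSpace ℝ (Fin m) → ℝ,
      ContDiff ℝ ∞ φ → HasCompactSupport φ → tsupport φ ⊆ Ω →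
        ∫ x in Ω, u x * fderiv ℝ φ x (EuclideanSpace.single i 1) = - ∫ x in Ω, g x * φ x

/-- `D` is (a version of) the Jacobian matrix of the map `f : Ω → ℝᵖ`, in the weak sense: the entry
in row `k` and column `i` is the weak derivative `∂fᵏ/∂xᵢ`. The row `D x k` represents the
differential `dfᵏ` at `x`. -/
def IsWeakJacobian {m p : ℕ} (Ω : Set (EuclideanSpace ℝ (Fin m)))
    (f : EuclideanSpace ℝ (Fin m) → EuclideanSpace ℝ (Fin p))
    (D : EuclideanSpace ℝ (Fin m) → Matrix (Fin p) (Fin m) ℝ) : Prop :=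
  ∀ (k : Fin p) (i : Fin m), IsWeakPartialDeriv Ω i (fun x => f x k) (fun x => D x k i)

/-- The local Sobolev space `W^{1,1}_loc(Ω, ℝᵖ)`: maps that are locally integrable in `Ω` and have
locally integrable weak first partial derivatives there. -/
def MemSobolevW11loc {m p : ℕ} (Ω : Set (EuclideanSpace ℝ (Fin m)))
    (f : EuclideanSpace ℝ (Fin m) → EuclideanSpace ℝ (Fin p)) : Prop :=
  LocallyIntegrableOn f Ω volume ∧
    ∃ D : EuclideanSpace ℝ (Fin m) → Matrix (Fin p) (Fin m) ℝ, IsWeakJacobian Ω f D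

/-- The (zero-based) position in `ℝ^{2n+1}` of the coordinate `j`, where `1 ≤ j ≤ n`. -/
def contactFst {n : ℕ} (j : Fin n) : Fin (2 * n + 1) := ⟨j, by omega⟩

/-- The (zero-based) position in `ℝ^{2n+1}` of the coordinate `j + n`, where `1 ≤ j ≤ n`. -/
def contactSnd {n : ℕ} (j : Fin n) : Fin (2 * n + 1) := ⟨j + n, by omega⟩

/-- The contact equation `df^{2n+1} = ∑_{j=1}^n (f^j df^{j+n} - f^{j+n} df^j)` at one point, where
`y` is the value of `f` and `A` is the Jacobian matrix of `f` at that point, whose rows are the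
differentials `dfᵏ`. -/
def ContactEquation {m n : ℕ} (y : EuclideanSpace ℝ (Fin (2 * n + 1)))
    (A : Matrix (Fin (2 * n + 1)) (Fin m) ℝ) : Prop :=
  A.row (Fin.last (2 * n)) =
    ∑ j : Fin n, (y (contactFst j) • A.row (contactSnd j) - y (contactSnd j) • A.row (contactFst j))

/-! Formally, taking the exterior derivative of the contact equation gives `2 ∑ df^j ∧ df^{j+n} =
0`, so the columns of the first `2n` rows of `Df` span an isotropic subspace of the symplectic space
`ℝ^{2n}`, of dimension at most `n`; the contact equation puts the last row in the span of the others
(`ContactEquation.rank_le`).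

For `W^{1,1}` maps the products of derivatives need not be integrable, so the exterior derivative is
replaced by circulation around small squares. Near a Lebesgue point of `Df`, averaging over base
points yields a small square on all of whose sides `f` is a primitive of its derivatives, the
contact equation holds a.e., and the derivatives are `ε`-close in mean to their values at that point
(`ae_segment_eq_add_integral`, `exists_segments_integral_le`). Along a side of length `r`, the
vertical increment is then the symplectic form of the horizontal endpoints up to `O(ε r²)`
(`abs_vertical_increment_sub_le`). The vertical increments cancel around the square, while the
symplectic terms add up to `2 r² ω(∂_p f, ∂_q f) + O(ε r²)` (`abs_loop_area_sub_le`). Dividing by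
`r²` and letting `ε → 0` gives isotropy. -/

/-! ### Translations and weak derivatives -/

/-- The shear `(t, x) ↦ (t, x + t • e)` preserves product measures. -/
lemma measurePreserving_shear {E : Type*} [NormedAddCommGroup E] [NormedSpace ℝ E]
    [FiniteDimensional ℝ E] [MeasurableSpace E] [BorelSpace E] (μ : Measure E)
    [μ.IsAddHaarMeasure] (ν : Measure ℝ) [SFinite ν] (e : E) :
    MeasurePreserving (fun p : ℝ × E => (p.1, p.2 + p.1 • e)) (ν.prod μ) (ν.prod μ) := by
  refine (MeasurePreserving.id ν).skew_product (g := fun t x => x + t • e) ?_ ?_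
  · exact (by fun_prop : Continuous fun p : ℝ × E => p.2 + p.1 • e).measurable
  · exact Filter.Eventually.of_forall fun t => (measurePreserving_add_right μ (t • e)).map_eq

/-- This is what makes Fubini available for integrals of `g` over segments of direction `e` with
variable base point. -/
lemma integrable_shear {E : Type*} [NormedAddCommGroup E] [NormedSpace ℝ E]
    [FiniteDimensional ℝ E] [MeasurableSpace E] [BorelSpace E] (μ : Measure E)
    [μ.IsAddHaarMeasure] (ν : Measure ℝ) [IsFiniteMeasure ν] (e : E) {g : E → ℝ}
    (hg : Integrable g μ) :
    Integrable (fun p : ℝ × E => g (p.2 + p.1 • e)) (ν.prod μ) :=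
  (measurePreserving_shear μ ν e).integrable_comp_of_integrable (hg.comp_snd ν)

/-- The fundamental theorem of calculus for weak derivatives, for a fixed displacement. -/
lemma ae_eq_add_integral_of_weak_deriv {E : Type*} [NormedAddCommGroup E] [NormedSpace ℝ E]
    [FiniteDimensional ℝ E] [MeasurableSpace E] [BorelSpace E] (μ : Measure E)
    [μ.IsAddHaarMeasure] {u g : E → ℝ} (hu : Integrable u μ) (hg : Integrable g μ)
    {e : E} {W V : Set E}
    (hweak : ∀ φ : E → ℝ, ContDiff ℝ ∞ φ → HasCompactSupport φ → tsupport φ ⊆ W →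
      ∫ x, u x * fderiv ℝ φ x e ∂μ = - ∫ x, g x * φ x ∂μ)
    (hV : IsOpen V) {s : ℝ} (hs : 0 ≤ s) (hVW : ∀ x ∈ V, ∀ t ∈ Set.Icc 0 s, x + t • e ∈ W) :
    ∀ᵐ x ∂μ, x ∈ V → u (x + s • e) = u x + ∫ t in (0 : ℝ)..s, g (x + t • e) := by
  have hG := integrable_shear μ (volume.restrict (Set.Ioc 0 s)) e hg
  have hu' : Integrable (fun x => u (x + s • e)) μ := hu.comp_add_right _
  have hI : Integrable (fun x => ∫ t in (0 : ℝ)..s, g (x + t • e)) μ := by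
    simp_rw [intervalIntegral.integral_of_le hs]
    exact hG.integral_prod_right
  have hJ := (hu'.sub hu).sub hI
  have key : ∀ᵐ x ∂μ, x ∈ V →
      (u (x + s • e) - u x) - ∫ t in (0 : ℝ)..s, g (x + t • e) = 0 := by
    refine hV.ae_eq_zero_of_integral_contDiff_smul_eq_zero
      (hJ.locallyIntegrable.locallyIntegrableOn V) ?_
    intro φ hφ hφc hφV
    obtain ⟨C, hC⟩ := hφc.exists_bound_of_continuous hφ.continuous
    have hφd : Continuous (fun x => fderiv ℝ φ x e) :=
      (hφ.continuous_fderiv (by simp)).clm_apply continuous_const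
    have hφdc : HasCompactSupport (fun x => fderiv ℝ φ x e) := hφc.fderiv_apply (𝕜 := ℝ) e
    obtain ⟨C', hC'⟩ := hφdc.exists_bound_of_continuous hφd
    have bdd : ∀ {h : E → ℝ}, Integrable h μ → Integrable (fun x => φ x * h x) μ := fun hh =>
      hh.bdd_mul hφ.continuous.aestronglyMeasurable (Filter.Eventually.of_forall hC)
    have shift : ∀ (h : E → ℝ) (ψ : E → ℝ) (t : ℝ),
        ∫ x, ψ x * h (x + t • e) ∂μ = ∫ x, h x * ψ (x - t • e) ∂μ := by
      intro h ψ t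
      rw [← integral_add_right_eq_self (fun x => h x * ψ (x - t • e)) (t • e)]
      simp [mul_comm]
    -- Moving the translation onto `φ` makes the pairing differentiable in `t` although `u` is only
    -- integrable. The translated test function is still supported in `W`, so the weak formula
    -- identifies the derivative.
    have hder : ∀ t ∈ Set.uIcc 0 s, HasDerivAt (fun t => ∫ x, φ x * u (x + t • e) ∂μ)
        (∫ x, φ x * g (x + t • e) ∂μ) t := by
      intro t ht
      rw [Set.uIcc_of_le hs] at ht
      have hw := hweak (fun x => φ (x - t • e)) (hφ.comp (contDiff_id.sub contDiff_const))
        (hφc.comp_homeomorph (Homeomorph.subRight (t • e))) (by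
          intro x hx
          have : x - t • e ∈ tsupport φ := by
            have := tsupport_comp_subset_preimage φ (f := fun x : E => x - t • e)
              (by fun_prop) hx
            exact this
          have := hVW _ (hφV this) t ht
          simpa using this)
      simp_rw [fderiv_comp_sub] at hw
      simp_rw [shift u φ]
      rw [shift g φ t, ← neg_eq_iff_eq_neg.mpr hw, ← integral_neg]
      have hd : ∀ (x : E) (t : ℝ), HasDerivAt (fun t => u x * φ (x - t • e))
          (-(u x * fderiv ℝ φ (x - t • e) e)) t := by
        intro x t
        have h1 : HasFDerivAt φ (fderiv ℝ φ (x - t • e)) (x - t • e) :=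
          (hφ.differentiable (by simp) _).hasFDerivAt
        have h2 : HasDerivAt (fun t : ℝ => x - t • e) (-e) t := by
          simpa using ((hasDerivAt_id t).smul_const e).const_sub x
        have := (h1.comp_hasDerivAt t h2).const_mul (u x)
        simpa using this
      have := hasDerivAt_integral_of_dominated_loc_of_deriv_le (μ := μ)
        (F := fun t x => u x * φ (x - t • e))
        (F' := fun t x => -(u x * fderiv ℝ φ (x - t • e) e)) (x₀ := t)
        (bound := fun x => C' * |u x|) (s := Set.univ) Filter.univ_mem
        (Filter.Eventually.of_forall fun t => hu.aestronglyMeasurable.mul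
          (hφ.continuous.comp (by fun_prop)).aestronglyMeasurable)
        (hu.mul_bdd (c := C) (hφ.continuous.comp (by fun_prop)).aestronglyMeasurable
          (Filter.Eventually.of_forall fun x => hC _))
        ((hu.aestronglyMeasurable.mul
          (hφd.comp (by fun_prop : Continuous fun x => x - t • e)).aestronglyMeasurable).neg)
        (Filter.Eventually.of_forall fun x t _ => by
          rw [norm_neg, norm_mul, mul_comm, Real.norm_eq_abs (u x)]
          exact mul_le_mul_of_nonneg_right (hC' _) (abs_nonneg _))
        (hu.abs.const_mul _)
        (Filter.Eventually.of_forall fun x t _ => hd x t)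
      exact this.2
    have hGφ : Integrable (fun p : ℝ × E => φ p.2 * g (p.2 + p.1 • e))
        ((volume.restrict (Set.Ioc 0 s)).prod μ) :=
      hG.bdd_mul (hφ.continuous.comp continuous_snd).aestronglyMeasurable
        (Filter.Eventually.of_forall fun p => hC _)
    have hftc := intervalIntegral.integral_eq_sub_of_hasDerivAt hder (by
      rw [intervalIntegrable_iff_integrableOn_Ioc_of_le hs]
      exact hGφ.integral_prod_left)
    rw [intervalIntegral.integral_of_le hs, integral_integral_swap hGφ] at hftc
    simp only [smul_eq_mul, mul_sub]
    rw [integral_sub (f := fun x => φ x * u (x + s • e) - φ x * u x) ((bdd hu').sub (bdd hu))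
      (bdd hI), integral_sub (bdd hu') (bdd hu)]
    simp only [zero_smul, add_zero, integral_const_mul] at hftc
    simp_rw [intervalIntegral.integral_of_le hs]
    linarith
  filter_upwards [key] with x hx hxV
  linarith [hx hxV]

/-! ### Linear algebra of isotropic columns -/

/-- The rank of a matrix is monotone in the span of its rows. -/
lemma Matrix.rank_le_rank_of_row_mem_span {ι κ τ K : Type*} [Finite ι] [Finite κ] [Fintype τ]
    [Field K] (A : Matrix ι τ K) (B : Matrix κ τ K)
    (h : ∀ i, A.row i ∈ Submodule.span K (Set.range B.row)) : A.rank ≤ B.rank := by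
  rw [Matrix.rank_eq_finrank_span_row, Matrix.rank_eq_finrank_span_row]
  exact Submodule.finrank_mono (Submodule.span_le.mpr (by rintro _ ⟨i, rfl⟩; exact h i))

/-- A matrix whose last row is the contact combination of the other ones and whose columns are
pairwise symplectically orthogonal has rank at most `n`. -/
lemma ContactEquation.rank_le {m n : ℕ} {y : EuclideanSpace ℝ (Fin (2 * n + 1))}
    {A : Matrix (Fin (2 * n + 1)) (Fin m) ℝ} (hA : ContactEquation y A)
    (hiso : ∀ p q, ∑ j : Fin n, (A (contactFst j) p * A (contactSnd j) q
      - A (contactSnd j) p * A (contactFst j) q) = 0) : A.rank ≤ n := by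
  let B : Matrix (Fin n ⊕ Fin n) (Fin m) ℝ :=
    Matrix.of (Sum.elim (fun j => A (contactFst j)) (fun j => A (contactSnd j)))
  let C : Matrix (Fin n ⊕ Fin n) (Fin m) ℝ :=
    Matrix.of (Sum.elim (fun j => A (contactSnd j)) (fun j => -A (contactFst j)))
  -- `C` is `B` with the standard complex structure applied to its rows, so the entries of `Bᵀ C`
  -- are the symplectic products of the columns. Since `C` has at least the rank of `B`, this forces
  -- `2 * B.rank ≤ 2 * n`.
  have hBC : B.transpose * C = 0 := by
    ext p q
    rw [Matrix.mul_apply, Fintype.sum_sum_type, ← Finset.sum_add_distrib]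
    simpa [B, C, sub_eq_add_neg] using hiso p q
  have h1 := Matrix.rank_add_rank_le_card_of_mul_eq_zero hBC
  rw [Matrix.rank_transpose, Fintype.card_sum, Fintype.card_fin] at h1
  have h2 : B.rank ≤ C.rank := by
    refine Matrix.rank_le_rank_of_row_mem_span _ _ ?_
    rintro (j | j)
    · have := Submodule.neg_mem _ (Submodule.subset_span (R := ℝ)
        (Set.mem_range_self (f := C.row) (Sum.inr j)))
      have hrow : B.row (Sum.inl j) = -C.row (Sum.inr j) := by
        ext p; simp [B, C, Matrix.row]
      rwa [hrow]
    · exact Submodule.subset_span ⟨Sum.inl j, rfl⟩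
  have hf : ∀ j, A.row (contactFst j) ∈ Submodule.span ℝ (Set.range B.row) := fun j =>
    Submodule.subset_span ⟨Sum.inl j, rfl⟩
  have hs : ∀ j, A.row (contactSnd j) ∈ Submodule.span ℝ (Set.range B.row) := fun j =>
    Submodule.subset_span ⟨Sum.inr j, rfl⟩
  have h3 : A.rank ≤ B.rank := by
    refine Matrix.rank_le_rank_of_row_mem_span _ _ fun k => ?_
    rcases lt_or_ge (k : ℕ) n with hk | hk
    · exact hf ⟨k, hk⟩
    rcases lt_or_ge (k : ℕ) (2 * n) with hk' | hk'
    · convert hs ⟨k - n, by omega⟩ using 2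
      ext
      simp [contactSnd]
      omega
    · have : k = Fin.last (2 * n) := Fin.ext (by simp; omega)
      rw [this, hA]
      exact Submodule.sum_mem _ fun j _ => Submodule.sub_mem _
        (Submodule.smul_mem _ _ (hs j)) (Submodule.smul_mem _ _ (hf j))
  omega

/-! ### Area estimates on a side and around a square -/

/-- If two functions are close in mean to constants, then the area swept by their primitives is
small. -/
lemma abs_integral_area_form_le {α β : ℝ → ℝ} {r ε L M : ℝ} (hr : 0 ≤ r) (hε : 0 ≤ ε)
    (hα : IntervalIntegrable α volume 0 r) (hβ : IntervalIntegrable β volume 0 r)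
    (hαL : ∫ s in (0 : ℝ)..r, |α s - L| ≤ ε * r) (hβM : ∫ s in (0 : ℝ)..r, |β s - M| ≤ ε * r) :
    IntervalIntegrable (fun s => (∫ t in (0 : ℝ)..s, α t) * β s - (∫ t in (0 : ℝ)..s, β t) * α s)
      volume 0 r ∧
    |∫ s in (0 : ℝ)..r, ((∫ t in (0 : ℝ)..s, α t) * β s - (∫ t in (0 : ℝ)..s, β t) * α s)|
      ≤ 2 * ε * r ^ 2 * (|L| + |M| + ε) := by
  have hcont : ∀ {γ : ℝ → ℝ}, IntervalIntegrable γ volume 0 r →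
      ContinuousOn (fun s => ∫ t in (0 : ℝ)..s, γ t) (Set.uIcc 0 r) := fun hγ =>
    intervalIntegral.continuousOn_primitive_interval' hγ (by simp)
  have hint := (hβ.continuousOn_mul (hcont hα)).sub (hα.continuousOn_mul (hcont hβ))
  have hdev : ∀ {γ : ℝ → ℝ} {N : ℝ}, IntervalIntegrable γ volume 0 r →
      ∫ s in (0 : ℝ)..r, |γ s - N| ≤ ε * r → ∀ s ∈ Set.Icc 0 r,
      |(∫ t in (0 : ℝ)..s, γ t) - s * N| ≤ ε * r := by
    intro γ N hγ hN s hs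
    have hγs : IntervalIntegrable γ volume 0 s := hγ.mono_set (by
      rw [Set.uIcc_of_le hr, Set.uIcc_of_le hs.1]; exact Set.Icc_subset_Icc_right hs.2)
    have : (∫ t in (0 : ℝ)..s, γ t) - s * N = ∫ t in (0 : ℝ)..s, (γ t - N) := by
      rw [intervalIntegral.integral_sub hγs (by simp)]; simp
    rw [this]
    refine (intervalIntegral.abs_integral_le_integral_abs hs.1).trans (le_trans ?_ hN)
    exact intervalIntegral.integral_mono_interval le_rfl hs.1 hs.2
      (Filter.Eventually.of_forall fun _ => abs_nonneg _) (hγ.sub (by simp)).abs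
  refine ⟨hint, ?_⟩
  have iα : IntervalIntegrable (fun s => |α s - L|) volume 0 r := (hα.sub (by simp)).abs
  have iβ : IntervalIntegrable (fun s => |β s - M|) volume 0 r := (hβ.sub (by simp)).abs
  have hb : ∀ s ∈ Set.Icc 0 r,
      |(∫ t in (0 : ℝ)..s, α t) * β s - (∫ t in (0 : ℝ)..s, β t) * α s| ≤
      ε * r * (|L| + |M|) + (ε * r + r * |M|) * |α s - L| + (ε * r + r * |L|) * |β s - M| := by
    intro s hs
    have h1 := hdev hα hαL s hs
    have h2 := hdev hβ hβM s hs
    set a := ∫ t in (0 : ℝ)..s, α t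
    set b := ∫ t in (0 : ℝ)..s, β t
    -- The main terms `s * L * M` cancel: a straight line through the origin sweeps no area. Every
    -- remaining term contains a deviation.
    have e : a * β s - b * α s = (a - s * L) * ((β s - M) + M) + -((b - s * M) * ((α s - L) + L))
        + (s * (L * (β s - M)) + -(s * (M * (α s - L)))) := by ring
    have hεr : 0 ≤ ε * r := by positivity
    have t1 : |(a - s * L) * ((β s - M) + M)| ≤ ε * r * (|β s - M| + |M|) := by
      rw [abs_mul]; gcongr; exact abs_add_le _ _
    have t2 : |(b - s * M) * ((α s - L) + L)| ≤ ε * r * (|α s - L| + |L|) := by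
      rw [abs_mul]; gcongr; exact abs_add_le _ _
    have t3 : |s * (L * (β s - M))| ≤ r * (|L| * |β s - M|) := by
      rw [abs_mul, abs_mul, abs_of_nonneg hs.1]; gcongr; exact hs.2
    have t4 : |s * (M * (α s - L))| ≤ r * (|M| * |α s - L|) := by
      rw [abs_mul, abs_mul, abs_of_nonneg hs.1]; gcongr; exact hs.2
    have u1 := abs_add_le ((a - s * L) * ((β s - M) + M) + -((b - s * M) * ((α s - L) + L)))
      (s * (L * (β s - M)) + -(s * (M * (α s - L))))
    have u2 := abs_add_le ((a - s * L) * ((β s - M) + M)) (-((b - s * M) * ((α s - L) + L)))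
    have u3 := abs_add_le (s * (L * (β s - M))) (-(s * (M * (α s - L))))
    rw [abs_neg] at u2 u3
    rw [e]
    linarith
  have i1 : IntervalIntegrable (fun s => ε * r * (|L| + |M|) + (ε * r + r * |M|) * |α s - L|)
      volume 0 r := (by simp : IntervalIntegrable _ _ _ _).add (iα.const_mul _)
  have i2 := iβ.const_mul (ε * r + r * |L|)
  calc _ ≤ ∫ s in (0 : ℝ)..r,
        |(∫ t in (0 : ℝ)..s, α t) * β s - (∫ t in (0 : ℝ)..s, β t) * α s| :=
        intervalIntegral.abs_integral_le_integral_abs hr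
    _ ≤ ∫ s in (0 : ℝ)..r, (ε * r * (|L| + |M|) + (ε * r + r * |M|) * |α s - L|
          + (ε * r + r * |L|) * |β s - M|) :=
        intervalIntegral.integral_mono_on hr hint.abs (i1.add i2) hb
    _ = r * (ε * r * (|L| + |M|)) + (ε * r + r * |M|) * (∫ s in (0 : ℝ)..r, |α s - L|)
          + (ε * r + r * |L|) * ∫ s in (0 : ℝ)..r, |β s - M| := by
        rw [intervalIntegral.integral_add i1 i2,
          intervalIntegral.integral_add (by simp) (iα.const_mul _)]
        simp only [intervalIntegral.integral_const, intervalIntegral.integral_const_mul, sub_zero,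
          smul_eq_mul]
        ring
    _ ≤ r * (ε * r * (|L| + |M|)) + (ε * r + r * |M|) * (ε * r)
          + (ε * r + r * |L|) * (ε * r) := by gcongr
    _ = _ := by ring

/-- Along an edge on which the horizontal derivatives are close in mean to constants, the increment
of the vertical component is close to the symplectic form of the endpoints. -/
lemma abs_vertical_increment_sub_le {J : Type*} [Fintype J] {a b : J → ℝ} {α β : J → ℝ → ℝ}
    {γ : ℝ → ℝ} {r ε K : ℝ} {L M : J → ℝ} (hr : 0 ≤ r) (hε : 0 ≤ ε)
    (hα : ∀ j, IntervalIntegrable (α j) volume 0 r)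
    (hβ : ∀ j, IntervalIntegrable (β j) volume 0 r)
    (hαL : ∀ j, ∫ s in (0 : ℝ)..r, |α j s - L j| ≤ ε * r)
    (hβM : ∀ j, ∫ s in (0 : ℝ)..r, |β j s - M j| ≤ ε * r)
    (hL : ∀ j, |L j| ≤ K) (hM : ∀ j, |M j| ≤ K)
    (hγ : ∀ᵐ s ∂volume.restrict (Set.Ioc 0 r), γ s =
      ∑ j, ((a j + ∫ t in (0 : ℝ)..s, α j t) * β j s - (b j + ∫ t in (0 : ℝ)..s, β j t) * α j s)) :
    |(∫ s in (0 : ℝ)..r, γ s) - ∑ j, (a j * (b j + ∫ s in (0 : ℝ)..r, β j s)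
        - b j * (a j + ∫ s in (0 : ℝ)..r, α j s))|
      ≤ Fintype.card J * (2 * ε * r ^ 2 * (2 * K + ε)) := by
  have h := fun j => abs_integral_area_form_le hr hε (hα j) (hβ j) (hαL j) (hβM j)
  have e1 : ∫ s in (0 : ℝ)..r, γ s = ∫ s in (0 : ℝ)..r,
      ∑ j, ((a j + ∫ t in (0 : ℝ)..s, α j t) * β j s
        - (b j + ∫ t in (0 : ℝ)..s, β j t) * α j s) := by
    rw [intervalIntegral.integral_of_le hr, intervalIntegral.integral_of_le hr]
    exact integral_congr_ae hγ
  have e2 : ∀ j s, (a j + ∫ t in (0 : ℝ)..s, α j t) * β j s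
        - (b j + ∫ t in (0 : ℝ)..s, β j t) * α j s = (a j * β j s - b j * α j s) +
        ((∫ t in (0 : ℝ)..s, α j t) * β j s - (∫ t in (0 : ℝ)..s, β j t) * α j s) := by
    intro j s; ring
  have e3 : (∫ s in (0 : ℝ)..r, γ s) = ∑ j, ((a j * (∫ s in (0 : ℝ)..r, β j s)
        - b j * (∫ s in (0 : ℝ)..r, α j s)) + ∫ s in (0 : ℝ)..r,
        ((∫ t in (0 : ℝ)..s, α j t) * β j s - (∫ t in (0 : ℝ)..s, β j t) * α j s)) := by
    simp_rw [e1, e2]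
    rw [intervalIntegral.integral_finsetSum fun j _ =>
      (((hβ j).const_mul _).sub ((hα j).const_mul _)).add (h j).1]
    refine Finset.sum_congr rfl fun j _ => ?_
    rw [intervalIntegral.integral_add (((hβ j).const_mul _).sub ((hα j).const_mul _)) (h j).1,
      intervalIntegral.integral_sub ((hβ j).const_mul _) ((hα j).const_mul _),
      intervalIntegral.integral_const_mul, intervalIntegral.integral_const_mul]
  rw [e3, ← Finset.sum_sub_distrib]
  refine (Finset.abs_sum_le_sum_abs _ _).trans ?_
  rw [← nsmul_eq_mul, ← Finset.card_univ]
  refine Finset.sum_le_card_nsmul _ _ _ fun j _ => ?_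
  have : ∀ x y z w u : ℝ, x * z - y * w + u - (x * (y + z) - y * (x + w)) = u := by
    intros; ring
  rw [this]
  refine (h j).2.trans ?_
  gcongr
  linarith [hL j, hM j]

/-- The symplectic area of a nearly affine parallelogram. -/
lemma abs_loop_area_sub_le {r ε K : ℝ} (hr : 0 ≤ r) (hε : 0 ≤ ε)
    {a₀ a₁ a₂ a₃ b₀ b₁ b₂ b₃ Lp Lq Mp Mq : ℝ}
    (hLp : |Lp| ≤ K) (hLq : |Lq| ≤ K) (hMp : |Mp| ≤ K) (hMq : |Mq| ≤ K)
    (ha₁ : |a₁ - a₀ - r * Lp| ≤ ε * r) (ha₂ : |a₂ - a₁ - r * Lq| ≤ ε * r)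
    (ha₃ : |a₃ - a₀ - r * Lq| ≤ ε * r)
    (hb₁ : |b₁ - b₀ - r * Mp| ≤ ε * r) (hb₂ : |b₂ - b₁ - r * Mq| ≤ ε * r)
    (hb₃ : |b₃ - b₀ - r * Mq| ≤ ε * r) :
    |(a₀ * b₁ - b₀ * a₁) + (a₁ * b₂ - b₁ * a₂) - (a₀ * b₃ - b₀ * a₃) - (a₃ * b₂ - b₃ * a₂)
      - 2 * r ^ 2 * (Lp * Mq - Mp * Lq)| ≤ 8 * ε * r ^ 2 * (2 * K + ε) := by
  have hK : 0 ≤ K := (abs_nonneg _).trans hLp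
  have hεr : 0 ≤ ε * r := by positivity
  rw [abs_le] at hLp hLq hMp hMq ha₁ ha₂ ha₃ hb₁ hb₂ hb₃
  -- The loop sum equals `(a₁ - a₃) * (b₂ - b₀) - (b₁ - b₃) * (a₂ - a₀)`, the symplectic product of
  -- the two diagonals, so it suffices to estimate these.
  have x₁ : |(a₁ - a₃) - r * (Lp - Lq)| ≤ 2 * (ε * r) := by rw [abs_le]; constructor <;> linarith
  have x₂ : |(a₂ - a₀) - r * (Lp + Lq)| ≤ 2 * (ε * r) := by rw [abs_le]; constructor <;> linarith
  have y₁ : |(b₁ - b₃) - r * (Mp - Mq)| ≤ 2 * (ε * r) := by rw [abs_le]; constructor <;> linarith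
  have y₂ : |(b₂ - b₀) - r * (Mp + Mq)| ≤ 2 * (ε * r) := by rw [abs_le]; constructor <;> linarith
  have prod : ∀ {X Y X' Y' : ℝ}, |X - r * X'| ≤ 2 * (ε * r) → |Y - r * Y'| ≤ 2 * (ε * r) →
      |X'| ≤ 2 * K → |Y'| ≤ 2 * K →
      |X * Y - r ^ 2 * (X' * Y')| ≤ 4 * ε * r ^ 2 * (2 * K + ε) := by
    intro X Y X' Y' h1 h2 h3 h4
    have e : X * Y - r ^ 2 * (X' * Y') = (X - r * X') * (Y - r * Y') + (X - r * X') * (r * Y')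
      + (r * X') * (Y - r * Y') := by ring
    have t1 : |(X - r * X') * (Y - r * Y')| ≤ 2 * (ε * r) * (2 * (ε * r)) := by
      rw [abs_mul]; gcongr
    have t2 : |(X - r * X') * (r * Y')| ≤ 2 * (ε * r) * (r * (2 * K)) := by
      rw [abs_mul, abs_mul, abs_of_nonneg hr]; gcongr
    have t3 : |(r * X') * (Y - r * Y')| ≤ (r * (2 * K)) * (2 * (ε * r)) := by
      rw [abs_mul, abs_mul, abs_of_nonneg hr]; gcongr
    rw [e]
    refine (abs_add_three _ _ _).trans ((add_le_add_three t1 t2 t3).trans (le_of_eq (by ring)))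
  have p₁ := prod x₁ y₂ (by rw [abs_le]; constructor <;> linarith)
    (by rw [abs_le]; constructor <;> linarith)
  have p₂ := prod y₁ x₂ (by rw [abs_le]; constructor <;> linarith)
    (by rw [abs_le]; constructor <;> linarith)
  rw [abs_le] at p₁ p₂ ⊢
  constructor <;> linarith

/-! ### Behaviour on almost every segment -/

/-- An almost everywhere property holds almost everywhere on almost every segment. -/
lemma ae_ae_segment {E : Type*} [NormedAddCommGroup E] [NormedSpace ℝ E]
    [FiniteDimensional ℝ E] [MeasurableSpace E] [BorelSpace E] (μ : Measure E)
    [μ.IsAddHaarMeasure] (ν : Measure ℝ) [SFinite ν] (e : E) {P : E → Prop}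
    (hP : ∀ᵐ x ∂μ, P x) : ∀ᵐ x ∂μ, ∀ᵐ s ∂ν, P (x + s • e) := by
  have h1 : ∀ᵐ p ∂(ν.prod μ), P p.2 := Measure.quasiMeasurePreserving_snd.ae hP
  have h2 := (measurePreserving_shear μ ν e).quasiMeasurePreserving.ae h1
  exact Measure.ae_ae_of_ae_prod
    ((Measure.measurePreserving_swap (μ := μ) (ν := ν)).quasiMeasurePreserving.ae h2)

/-- An integrable function is integrable on almost every segment of a given direction. -/
lemma ae_intervalIntegrable_segment {E : Type*} [NormedAddCommGroup E] [NormedSpace ℝ E]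
    [FiniteDimensional ℝ E] [MeasurableSpace E] [BorelSpace E] (μ : Measure E)
    [μ.IsAddHaarMeasure] {g : E → ℝ} (hg : Integrable g μ) (e : E) {r : ℝ} (hr : 0 ≤ r) :
    ∀ᵐ x ∂μ, IntervalIntegrable (fun t => g (x + t • e)) volume 0 r := by
  filter_upwards [(integrable_shear μ (volume.restrict (Set.Ioc 0 r)) e hg).prod_left_ae] with x hx
  rwa [intervalIntegrable_iff_integrableOn_Ioc_of_le hr]

/-- A function with weak derivative `g` in the direction `e` is the primitive of `g` on almost every
segment of that direction. -/
lemma ae_segment_eq_add_integral {E : Type*} [NormedAddCommGroup E] [NormedSpace ℝ E]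
    [FiniteDimensional ℝ E] [MeasurableSpace E] [BorelSpace E] (μ : Measure E)
    [μ.IsAddHaarMeasure] {u g : E → ℝ} (hu : Integrable u μ) (hg : Integrable g μ)
    (hum : Measurable u) (hgm : Measurable g) {e : E} {W V : Set E}
    (hweak : ∀ φ : E → ℝ, ContDiff ℝ ∞ φ → HasCompactSupport φ → tsupport φ ⊆ W →
      ∫ x, u x * fderiv ℝ φ x e ∂μ = - ∫ x, g x * φ x ∂μ)
    (hV : IsOpen V) {r : ℝ} (hr : 0 ≤ r) (hVW : ∀ x ∈ V, ∀ t ∈ Set.Icc 0 r, x + t • e ∈ W) :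
    ∀ᵐ x ∂μ, x ∈ V → IntervalIntegrable (fun t => g (x + t • e)) volume 0 r ∧
      u (x + r • e) = u x + (∫ t in (0 : ℝ)..r, g (x + t • e)) ∧
      ∀ᵐ s ∂volume.restrict (Set.Ioc 0 r),
        u (x + s • e) = u x + ∫ t in (0 : ℝ)..s, g (x + t • e) := by
  have h1 := ae_eq_add_integral_of_weak_deriv μ hu hg hweak hV hr hVW
  have h2 := ae_intervalIntegrable_segment μ hg e hr
  -- The exceptional null set of base points depends on `s`, so the quantifiers over `s` and `x`
  -- must be exchanged. This needs joint measurability, for which the integral is written over all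
  -- of `ℝ` with a cut-off.
  have hm : MeasurableSet {p : ℝ × E | p.2 ∈ V → u (p.2 + p.1 • e) =
      u p.2 + ∫ t, (if 0 < t ∧ t ≤ p.1 then g (p.2 + t • e) else 0)} := by
    have hI : Measurable fun p : ℝ × E =>
        ∫ t, (if 0 < t ∧ t ≤ p.1 then g (p.2 + t • e) else 0) := by
      refine (StronglyMeasurable.integral_prod_right
        (f := fun (p : ℝ × E) (t : ℝ) => if 0 < t ∧ t ≤ p.1 then g (p.2 + t • e) else 0)
        ?_).measurable
      refine Measurable.stronglyMeasurable ?_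
      refine Measurable.ite ?_ (hgm.comp ?_) measurable_const
      · exact (measurableSet_lt measurable_const measurable_snd).inter
          (measurableSet_le measurable_snd (measurable_fst.comp measurable_fst))
      · exact (by fun_prop : Continuous fun q : (ℝ × E) × ℝ => q.1.2 + q.2 • e).measurable
    have hA : Measurable fun p : ℝ × E => u (p.2 + p.1 • e) :=
      hum.comp (by fun_prop : Continuous fun p : ℝ × E => p.2 + p.1 • e).measurable
    exact (measurable_snd hV.measurableSet).imp
      (measurableSet_eq_fun hA ((hum.comp measurable_snd).add hI))
  have hI : ∀ s x, 0 ≤ s → ∫ t in (0 : ℝ)..s, g (x + t • e) =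
      ∫ t, (if 0 < t ∧ t ≤ s then g (x + t • e) else 0) := by
    intro s x hs
    rw [intervalIntegral.integral_of_le hs, ← integral_indicator measurableSet_Ioc]
    simp only [Set.indicator_apply, Set.mem_Ioc]
  have h3 : ∀ᵐ s ∂volume.restrict (Set.Ioc 0 r), ∀ᵐ x ∂μ, x ∈ V → u (x + s • e) =
      u x + ∫ t, (if 0 < t ∧ t ≤ s then g (x + t • e) else 0) := by
    filter_upwards [ae_restrict_mem measurableSet_Ioc] with s hs
    filter_upwards [ae_eq_add_integral_of_weak_deriv μ hu hg hweak hV hs.1.le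
      fun x hx t ht => hVW x hx t ⟨ht.1, ht.2.trans hs.2⟩] with x hx hxV
    rw [hx hxV, hI s x hs.1.le]
  rw [Measure.ae_ae_comm hm] at h3
  filter_upwards [h1, h2, h3] with x x1 x2 x3 hxV
  refine ⟨x2, x1 hxV, ?_⟩
  filter_upwards [x3, ae_restrict_mem measurableSet_Ioc] with s hs hs'
  rw [hs hxV, hI s x hs'.1.le]

/-- The first moment method for finitely many segments issuing from a common point. -/
lemma exists_segments_integral_le {E : Type*} [NormedAddCommGroup E] [NormedSpace ℝ E]
    [FiniteDimensional ℝ E] [MeasurableSpace E] [BorelSpace E] (μ : Measure E)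
    [μ.IsAddHaarMeasure] {ι : Type*} [Fintype ι] (v e : ι → E) {H : E → ℝ}
    (hH : Integrable H μ) (hH0 : ∀ x, 0 ≤ H x) {r : ℝ} (hr : 0 ≤ r) {B : Set E}
    (hB : MeasurableSet B) (hB0 : μ B ≠ 0) (hBt : μ B ≠ ⊤) {Q : E → Prop}
    (hQ : ∀ᵐ x ∂μ, x ∈ B → Q x) :
    ∃ x ∈ B, Q x ∧ ∀ l, ∫ s in (0 : ℝ)..r, H (x + v l + s • e l) ≤
      Fintype.card ι * r * (∫ x, H x ∂μ) / μ.real B := by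
  have hS : ∀ l, Integrable (fun p : ℝ × E => H (p.2 + v l + p.1 • e l))
      ((volume.restrict (Set.Ioc 0 r)).prod μ) := by
    intro l
    have := integrable_shear μ (volume.restrict (Set.Ioc 0 r)) (e l) (hH.comp_add_right (v l))
    simpa only [add_right_comm] using this
  have hI : ∀ l, Integrable (fun x => ∫ s in (0 : ℝ)..r, H (x + v l + s • e l)) μ := by
    intro l
    simp_rw [intervalIntegral.integral_of_le hr]
    exact (hS l).integral_prod_right
  have hI0 : ∀ l x, 0 ≤ ∫ s in (0 : ℝ)..r, H (x + v l + s • e l) := fun l x =>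
    intervalIntegral.integral_nonneg hr fun _ _ => hH0 _
  have hval : ∀ l, ∫ x, (∫ s in (0 : ℝ)..r, H (x + v l + s • e l)) ∂μ = r * ∫ x, H x ∂μ := by
    intro l
    simp_rw [intervalIntegral.integral_of_le hr]
    rw [← integral_integral_swap (hS l)]
    have : ∀ s : ℝ, ∫ x, H (x + v l + s • e l) ∂μ = ∫ x, H x ∂μ := by
      intro s
      simp_rw [add_assoc]
      exact integral_add_right_eq_self _ _
    simp [this, hr]
  have hsum : Integrable (fun x => ∑ l, ∫ s in (0 : ℝ)..r, H (x + v l + s • e l)) μ :=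
    integrable_finsetSum _ fun l _ => hI l
  have : IsFiniteMeasure (μ.restrict B) := ⟨by simpa using hBt.lt_top⟩
  have hN : ∀ᵐ x ∂μ.restrict B, x ∈ B ∧ Q x := by
    filter_upwards [ae_restrict_mem hB, ae_restrict_of_ae hQ] with x h1 h2 using ⟨h1, h2 h1⟩
  -- Some point outside the null set has its sum over all segments at most the average over `B`. By
  -- translation invariance each segment contributes at most `r * ∫ H` to the integral.
  obtain ⟨x, hxN, hx⟩ := exists_notMem_null_le_average (μ := μ.restrict B) (by simpa using hB0)
    hsum.integrableOn (ae_iff.mp hN)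
  simp only [Set.mem_ofPred_eq, not_not] at hxN
  refine ⟨x, hxN.1, hxN.2, fun l => ?_⟩
  refine (Finset.single_le_sum (fun l _ => hI0 l x) (Finset.mem_univ l)).trans (hx.trans ?_)
  rw [setAverage_eq, smul_eq_mul, ← div_eq_inv_mul]
  refine div_le_div_of_nonneg_right ?_ measureReal_nonneg
  refine (setIntegral_le_integral hsum (Filter.Eventually.of_forall fun x =>
    Finset.sum_nonneg fun l _ => hI0 l x)).trans ?_
  rw [integral_finsetSum _ fun l _ => hI l]
  simp [hval, mul_assoc]

/-! ### Contact segments and squares -/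

/-- On the segment from `x` to `x + r • e`, the functions `F k` are primitives of the functions
`G k`, and the latter satisfy the contact equation, with vertical component `c` and conjugate
horizontal components `a j`, `b j`. -/
structure IsContactSegment {E J κ : Type*} [NormedAddCommGroup E] [NormedSpace ℝ E] [Fintype J]
    (F G : κ → E → ℝ) (a b : J → κ) (c : κ) (e : E) (r : ℝ) (x : E) : Prop where
  integrable : ∀ k, IntervalIntegrable (fun t => G k (x + t • e)) volume 0 r
  increment : ∀ k, F k (x + r • e) = F k x + ∫ t in (0 : ℝ)..r, G k (x + t • e)
  primitive : ∀ k, ∀ᵐ s ∂volume.restrict (Set.Ioc 0 r),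
    F k (x + s • e) = F k x + ∫ t in (0 : ℝ)..s, G k (x + t • e)
  contact : ∀ᵐ s ∂volume.restrict (Set.Ioc 0 r), G c (x + s • e) =
    ∑ j, (F (a j) (x + s • e) * G (b j) (x + s • e) - F (b j) (x + s • e) * G (a j) (x + s • e))

namespace IsContactSegment

variable {E J κ : Type*} [NormedAddCommGroup E] [NormedSpace ℝ E] [Fintype J]
  {F G : κ → E → ℝ} {a b : J → κ} {c : κ} {e : E} {r : ℝ} {x : E}

lemma abs_increment_sub_le (h : IsContactSegment F G a b c e r x) (hr : 0 ≤ r) {ε L : ℝ} {k : κ}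
    (hL : ∫ s in (0 : ℝ)..r, |G k (x + s • e) - L| ≤ ε * r) :
    |F k (x + r • e) - F k x - r * L| ≤ ε * r := by
  have : F k (x + r • e) - F k x - r * L = ∫ s in (0 : ℝ)..r, (G k (x + s • e) - L) := by
    rw [h.increment k, intervalIntegral.integral_sub (h.integrable k) (by simp)]
    simp
  rw [this]
  exact (intervalIntegral.abs_integral_le_integral_abs hr).trans hL

/-- Inserting the primitives into the contact equation leaves, besides the symplectic form of the
endpoints, only the area swept relative to the starting point, which is small for a nearly straight
curve. -/
lemma abs_vertical_sub_le (h : IsContactSegment F G a b c e r x) (hr : 0 ≤ r) {ε K : ℝ}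
    (hε : 0 ≤ ε) {L : κ → ℝ} (hK : ∀ k, |L k| ≤ K)
    (hL : ∀ k, ∫ s in (0 : ℝ)..r, |G k (x + s • e) - L k| ≤ ε * r) :
    |F c (x + r • e) - F c x - ∑ j, (F (a j) x * F (b j) (x + r • e)
      - F (b j) x * F (a j) (x + r • e))| ≤ Fintype.card J * (2 * ε * r ^ 2 * (2 * K + ε)) := by
  have := abs_vertical_increment_sub_le (a := fun j => F (a j) x) (b := fun j => F (b j) x)
    (α := fun j s => G (a j) (x + s • e)) (β := fun j s => G (b j) (x + s • e))
    (γ := fun s => G c (x + s • e)) hr hε (fun j => h.integrable _) (fun j => h.integrable _)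
    (fun j => hL (a j)) (fun j => hL (b j)) (fun j => hK _) (fun j => hK _) (by
      have ha : ∀ᵐ s ∂volume.restrict (Set.Ioc 0 r), ∀ j, F (a j) (x + s • e) =
          F (a j) x + ∫ t in (0 : ℝ)..s, G (a j) (x + t • e) :=
        ae_all_iff.mpr fun j => h.primitive (a j)
      have hb : ∀ᵐ s ∂volume.restrict (Set.Ioc 0 r), ∀ j, F (b j) (x + s • e) =
          F (b j) x + ∫ t in (0 : ℝ)..s, G (b j) (x + t • e) :=
        ae_all_iff.mpr fun j => h.primitive (b j)
      filter_upwards [ha, hb, h.contact] with s h1 h2 h3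
      rw [h3]
      exact Finset.sum_congr rfl fun j _ => by rw [h1, h2])
  simp_rw [← h.increment] at this
  rwa [show F c (x + r • e) - F c x = ∫ s in (0 : ℝ)..r, G c (x + s • e) by
    rw [h.increment c]; ring]

end IsContactSegment

/-- If the four sides of a small square are contact segments on which the derivatives are close in
mean to constants `L`, then the two columns of `L` are nearly symplectically orthogonal. -/
lemma abs_symplectic_le_of_contact_square {E I J κ : Type*} [NormedAddCommGroup E]
    [NormedSpace ℝ E] [Fintype J] {F : κ → E → ℝ} {G : κ → I → E → ℝ} {a b : J → κ} {c : κ}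
    {e : I → E} {r ε K : ℝ} {x : E} {p q : I} {L : κ → I → ℝ} (hr : 0 < r) (hε : 0 ≤ ε)
    (hK : ∀ k i, |L k i| ≤ K)
    (h₁ : IsContactSegment F (fun k => G k p) a b c (e p) r x)
    (h₂ : IsContactSegment F (fun k => G k q) a b c (e q) r (x + r • e p))
    (h₃ : IsContactSegment F (fun k => G k q) a b c (e q) r x)
    (h₄ : IsContactSegment F (fun k => G k p) a b c (e p) r (x + r • e q))
    (m₁ : ∀ k, ∫ s in (0 : ℝ)..r, |G k p (x + s • e p) - L k p| ≤ ε * r)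
    (m₂ : ∀ k, ∫ s in (0 : ℝ)..r, |G k q (x + r • e p + s • e q) - L k q| ≤ ε * r)
    (m₃ : ∀ k, ∫ s in (0 : ℝ)..r, |G k q (x + s • e q) - L k q| ≤ ε * r)
    (m₄ : ∀ k, ∫ s in (0 : ℝ)..r, |G k p (x + r • e q + s • e p) - L k p| ≤ ε * r) :
    |∑ j, (L (a j) p * L (b j) q - L (b j) p * L (a j) q)|
      ≤ Fintype.card J * (8 * ε * (2 * K + ε)) := by
  have v₁ := h₁.abs_vertical_sub_le hr.le hε (fun k => hK k p) m₁
  have v₂ := h₂.abs_vertical_sub_le hr.le hε (fun k => hK k q) m₂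
  have v₃ := h₃.abs_vertical_sub_le hr.le hε (fun k => hK k q) m₃
  have v₄ := h₄.abs_vertical_sub_le hr.le hε (fun k => hK k p) m₄
  have d₁ := fun k => h₁.abs_increment_sub_le hr.le (m₁ k)
  have d₂ := fun k => h₂.abs_increment_sub_le hr.le (m₂ k)
  have d₃ := fun k => h₃.abs_increment_sub_le hr.le (m₃ k)
  -- Both paths around the square end at the same corner, so the values of `F c` cancel in the final
  -- combination.
  rw [add_right_comm x (r • e q)] at v₄
  have loop := fun j => abs_loop_area_sub_le hr.le hε (hK (a j) p) (hK (a j) q) (hK (b j) p)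
    (hK (b j) q) (d₁ (a j)) (d₂ (a j)) (d₃ (a j)) (d₁ (b j)) (d₂ (b j)) (d₃ (b j))
  have hsum := (Finset.abs_sum_le_sum_abs _ Finset.univ).trans
    (Finset.sum_le_card_nsmul Finset.univ _ _ fun j _ => loop j)
  rw [nsmul_eq_mul, Finset.card_univ, Finset.sum_sub_distrib, Finset.sum_sub_distrib,
    Finset.sum_sub_distrib, Finset.sum_add_distrib, ← Finset.mul_sum] at hsum
  set S := ∑ j, (L (a j) p * L (b j) q - L (b j) p * L (a j) q)
  have h2 : 2 * r ^ 2 * |S| ≤ 2 * r ^ 2 * (Fintype.card J * (8 * ε * (2 * K + ε))) := by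
    rw [← abs_of_pos (by positivity : 0 < 2 * r ^ 2), ← abs_mul,
      abs_of_pos (by positivity : 0 < 2 * r ^ 2)]
    rw [abs_le] at v₁ v₂ v₃ v₄ hsum ⊢
    constructor <;> linarith
  exact le_of_mul_le_mul_left h2 (by positivity)

/-! ### Isotropy at Lebesgue points -/

open Filter Topology in
/-- At almost every point, the weak derivatives of a map satisfying the contact equation span an
isotropic subspace. -/
theorem ae_symplectic_eq_zero_of_contact {E I J κ : Type*} [NormedAddCommGroup E] [NormedSpace ℝ E]
    [FiniteDimensional ℝ E] [MeasurableSpace E] [BorelSpace E] (μ : Measure E)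
    [μ.IsAddHaarMeasure] [Fintype I] [Fintype J] [Fintype κ] {F : κ → E → ℝ} {G : κ → I → E → ℝ}
    {a b : J → κ} {c : κ} {e : I → E} (he : ∀ i, ‖e i‖ ≤ 1) {W : Set E} (hW : IsOpen W)
    (hF : ∀ k, Integrable (F k) μ) (hFm : ∀ k, Measurable (F k))
    (hG : ∀ k i, Integrable (G k i) μ) (hGm : ∀ k i, Measurable (G k i))
    (hweak : ∀ k i, ∀ φ : E → ℝ, ContDiff ℝ ∞ φ → HasCompactSupport φ → tsupport φ ⊆ W →
      ∫ x, F k x * fderiv ℝ φ x (e i) ∂μ = - ∫ x, G k i x * φ x ∂μ)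
    (hcontact : ∀ᵐ x ∂μ, x ∈ W → ∀ i, G c i x =
      ∑ j, (F (a j) x * G (b j) i x - F (b j) x * G (a j) i x)) :
    ∀ᵐ x ∂μ, x ∈ W → ∀ p q,
      ∑ j, (G (a j) p x * G (b j) q x - G (b j) p x * G (a j) q x) = 0 := by
  have leb : ∀ᵐ x ∂μ, ∀ k i, Tendsto
      (fun R => ⨍ y in Metric.closedBall x R, ‖G k i y - G k i x‖ ∂μ) (𝓝[>] 0) (𝓝 0) := by
    refine ae_all_iff.mpr fun k => ae_all_iff.mpr fun i => ?_
    filter_upwards [IsUnifLocDoublingMeasure.ae_tendsto_average_norm_sub μ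
      (hG k i).locallyIntegrable 1] with x hx
    refine hx (fun _ => x) id tendsto_id ?_
    filter_upwards [self_mem_nhdsWithin] with R hR
    simpa using (le_of_lt hR : (0 : ℝ) ≤ R)
  filter_upwards [leb] with x₀ hx₀ hxW p q
  set L : κ → I → ℝ := fun k i => G k i x₀
  set K : ℝ := ∑ k, ∑ i, |L k i|
  have hK : ∀ k i, |L k i| ≤ K := fun k i =>
    (Finset.single_le_sum (f := fun i => |L k i|) (fun _ _ => abs_nonneg _)
      (Finset.mem_univ i)).trans (Finset.single_le_sum (f := fun k => ∑ i, |L k i|)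
      (fun _ _ => Finset.sum_nonneg fun _ _ => abs_nonneg _) (Finset.mem_univ k))
  suffices hmain : ∀ ε ∈ Set.Ioi (0 : ℝ),
      |∑ j, (L (a j) p * L (b j) q - L (b j) p * L (a j) q)|
        ≤ Fintype.card J * (8 * ε * (2 * K + ε)) by
    have ht : Tendsto (fun ε : ℝ => (Fintype.card J : ℝ) * (8 * ε * (2 * K + ε)))
        (𝓝[>] 0) (𝓝 0) := by
      have : Continuous fun ε : ℝ => (Fintype.card J : ℝ) * (8 * ε * (2 * K + ε)) := by fun_prop
      simpa using (this.tendsto 0).mono_left nhdsWithin_le_nhds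
    exact abs_nonpos_iff.mp (ge_of_tendsto ht
      (eventually_of_mem self_mem_nhdsWithin hmain))
  intro ε (hε : 0 < ε)
  -- `D` is the volume ratio of balls of radii `R` and `r = R / 4`. The threshold `ε / (4 * D)`
  -- below pays for this ratio and for the four sides.
  set D : ℝ := 4 ^ Module.finrank ℝ E with hD
  have hDpos : 0 < D := by positivity
  obtain ⟨ρ, hρ, hρW⟩ := Metric.nhds_basis_closedBall.mem_iff.mp (hW.mem_nhds hxW)
  have hsum : Tendsto (fun R => ∑ k, ∑ i, ⨍ y in Metric.closedBall x₀ R, ‖G k i y - L k i‖ ∂μ)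
      (𝓝[>] 0) (𝓝 0) := by
    simpa using tendsto_finsetSum Finset.univ fun k _ =>
      tendsto_finsetSum Finset.univ fun i _ => hx₀ k i
  obtain ⟨R, hRδ, hR, hRρ⟩ := ((hsum.eventually_lt_const
    (by positivity : 0 < ε / (4 * D))).and (Ioc_mem_nhdsGT hρ)).exists
  have hRW : Metric.closedBall x₀ R ⊆ W := (Metric.closedBall_subset_closedBall hRρ).trans hρW
  -- With the base point within `r` of `x₀`, the sides start within `2 * r` and stay within `3 * r <
  -- R`.
  set r := R / 4 with hrdef
  have hr : 0 < r := by positivity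
  have hnorm : ∀ i, ∀ t ∈ Set.Icc 0 r, ‖t • e i‖ ≤ r := fun i t ht => by
    rw [norm_smul, Real.norm_eq_abs, abs_of_nonneg ht.1]
    exact (mul_le_of_le_one_right ht.1 (he i)).trans ht.2
  have hmove : ∀ (x : E) (s : ℝ) (w : E), x ∈ Metric.ball x₀ s → ‖w‖ ≤ r →
      x + w ∈ Metric.ball x₀ (s + r) := by
    intro x s w hx hw
    rw [mem_ball_iff_norm] at hx ⊢
    have := norm_add_le (x - x₀) w
    rw [add_sub_right_comm]
    linarith
  have hball3 : Metric.ball x₀ (r + r + r) ⊆ Metric.closedBall x₀ R :=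
    (Metric.ball_subset_ball (by linarith)).trans Metric.ball_subset_closedBall
  have hseg : ∀ i, ∀ᵐ x ∂μ, x ∈ Metric.ball x₀ (r + r) →
      IsContactSegment F (fun k => G k i) a b c (e i) r x := by
    intro i
    have hVW : ∀ x ∈ Metric.ball x₀ (r + r), ∀ t ∈ Set.Icc 0 r, x + t • e i ∈ W :=
      fun x hx t ht => hRW (hball3 (hmove x _ _ hx (hnorm i t ht)))
    have h1 := ae_all_iff.mpr fun k => ae_segment_eq_add_integral μ (hF k) (hG k i) (hFm k)
      (hGm k i) (hweak k i) Metric.isOpen_ball hr.le hVW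
    filter_upwards [h1, ae_ae_segment μ (volume.restrict (Set.Ioc 0 r)) (e i) hcontact]
      with x x1 x2 hx
    refine ⟨fun k => (x1 k hx).1, fun k => (x1 k hx).2.1, fun k => (x1 k hx).2.2, ?_⟩
    filter_upwards [x2, ae_restrict_mem measurableSet_Ioc] with s hs hs'
    exact hs (hVW x hx s ⟨hs'.1.le, hs'.2⟩) i
  -- A single function dominates all deviations on the ball, so one choice of base point serves
  -- every component and direction.
  let H : E → ℝ := fun y => ∑ k, ∑ i,
    (Metric.closedBall x₀ R).indicator (fun y => ‖G k i y - L k i‖) y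
  have hind : ∀ k i, Integrable
      ((Metric.closedBall x₀ R).indicator fun y => ‖G k i y - L k i‖) μ := by
    intro k i
    rw [integrable_indicator_iff Metric.isClosed_closedBall.measurableSet]
    exact ((hG k i).integrableOn.sub
      (integrableOn_const (isCompact_closedBall x₀ R).measure_lt_top.ne)).norm
  have hH : Integrable H μ :=
    integrable_finsetSum _ fun k _ => integrable_finsetSum _ fun i _ => hind k i
  have hi0 : ∀ k i y, 0 ≤ (Metric.closedBall x₀ R).indicator (fun y => ‖G k i y - L k i‖) y :=
    fun k i y => Set.indicator_nonneg (fun _ _ => norm_nonneg _) y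
  have hH0 : ∀ y, 0 ≤ H y := fun y =>
    Finset.sum_nonneg fun k _ => Finset.sum_nonneg fun i _ => hi0 k i y
  have hle : ∀ k i, ∀ y ∈ Metric.closedBall x₀ R, |G k i y - L k i| ≤ H y := by
    intro k i y hy
    have h1 := (Finset.single_le_sum (fun i _ => hi0 k i y) (Finset.mem_univ i)).trans
      (Finset.single_le_sum (fun k _ => Finset.sum_nonneg fun i _ => hi0 k i y)
        (Finset.mem_univ k))
    rwa [Set.indicator_of_mem hy] at h1
  have hvol : μ.real (Metric.closedBall x₀ R) = D * μ.real (Metric.ball x₀ r) := by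
    rw [Measure.addHaar_real_closedBall μ x₀ hR.le, measureReal_def μ (Metric.ball x₀ r),
      Measure.addHaar_ball_of_pos μ x₀ hr, ENNReal.toReal_mul,
      ENNReal.toReal_ofReal (by positivity), ← measureReal_def, hD, ← mul_assoc, ← mul_pow, hrdef]
    congr 2
    ring
  have hBpos : 0 < μ.real (Metric.ball x₀ r) :=
    ENNReal.toReal_pos (Metric.measure_ball_pos μ x₀ hr).ne' measure_ball_lt_top.ne
  have hHint : ∫ y, H y ∂μ ≤ D * μ.real (Metric.ball x₀ r) * (ε / (4 * D)) := by
    have : ∫ y, H y ∂μ = μ.real (Metric.closedBall x₀ R) *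
        ∑ k, ∑ i, ⨍ y in Metric.closedBall x₀ R, ‖G k i y - L k i‖ ∂μ := by
      rw [integral_finsetSum _ fun k _ => integrable_finsetSum _ fun i _ => hind k i,
        Finset.mul_sum]
      refine Finset.sum_congr rfl fun k _ => ?_
      rw [integral_finsetSum _ fun i _ => hind k i, Finset.mul_sum]
      refine Finset.sum_congr rfl fun i _ => ?_
      rw [integral_indicator Metric.isClosed_closedBall.measurableSet, setAverage_eq, smul_eq_mul,
        mul_inv_cancel_left₀]
      rw [hvol]
      positivity
    rw [this, ← hvol]
    exact mul_le_mul_of_nonneg_left hRδ.le measureReal_nonneg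
  -- Starting points, relative to `x`, and directions of the four sides: first `p` then `q`, and
  -- first `q` then `p`.
  let v : Fin 4 → E := ![0, r • e p, 0, r • e q]
  let d : Fin 4 → I := ![p, q, q, p]
  have hv : ∀ l, ‖v l‖ ≤ r := by
    have := hnorm p r ⟨hr.le, le_rfl⟩
    have := hnorm q r ⟨hr.le, le_rfl⟩
    intro l
    fin_cases l <;> simp [v, hr.le] <;> assumption
  have hQ : ∀ᵐ x ∂μ, x ∈ Metric.ball x₀ r → ∀ l,
      IsContactSegment F (fun k => G k (d l)) a b c (e (d l)) r (x + v l) ∧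
      IntervalIntegrable (fun s => H (x + v l + s • e (d l))) volume 0 r := by
    have hQ' := ae_all_iff.mpr fun l : Fin 4 =>
      (measurePreserving_add_right μ (v l)).quasiMeasurePreserving.ae
        ((hseg (d l)).and (ae_intervalIntegrable_segment μ hH (e (d l)) hr.le))
    filter_upwards [hQ'] with x hx hxB l
    exact ⟨(hx l).1 (hmove x r _ hxB (hv l)), (hx l).2⟩
  obtain ⟨x, hxB, hx, hxH⟩ := exists_segments_integral_le μ v (fun l => e (d l)) hH hH0 hr.le
    Metric.isOpen_ball.measurableSet (Metric.measure_ball_pos μ x₀ hr).ne'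
    measure_ball_lt_top.ne hQ
  have hm : ∀ l k, ∫ s in (0 : ℝ)..r, |G k (d l) (x + v l + s • e (d l)) - L k (d l)|
      ≤ ε * r := by
    intro l k
    refine (intervalIntegral.integral_mono_on hr.le
      (((hx l).1.integrable k).sub (by simp)).abs (hx l).2 fun s hs => ?_).trans
      ((hxH l).trans ?_)
    · exact hle k (d l) _ (hball3 (hmove _ _ _ (hmove x r _ hxB (hv l)) (hnorm _ s hs)))
    · rw [div_le_iff₀ hBpos, Fintype.card_fin]
      calc _ ≤ ((4 : ℕ) : ℝ) * r * (D * μ.real (Metric.ball x₀ r) * (ε / (4 * D))) := by gcongr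
        _ = ε * r * μ.real (Metric.ball x₀ r) := by push_cast; field_simp
  have s₁ := (hx 0).1
  have s₂ := (hx 1).1
  have s₃ := (hx 2).1
  have s₄ := (hx 3).1
  have m₁ := hm 0
  have m₂ := hm 1
  have m₃ := hm 2
  have m₄ := hm 3
  simp only [v, d, Matrix.cons_val, add_zero] at s₁ s₂ s₃ s₄ m₁ m₂ m₃ m₄
  exact abs_symplectic_le_of_contact_square hr hε.le hK s₁ s₂ s₃ s₄ m₁ m₂ m₃ m₄

/-! ### Localisation and conclusion -/

/-- The integration by parts formula survives localisation to an open set containing the support of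
the test function, and modification on a null set. -/
lemma IsWeakPartialDeriv.integral_mul_fderiv {m : ℕ} {Ω W : Set (EuclideanSpace ℝ (Fin m))}
    {i : Fin m} {u g u' g' : EuclideanSpace ℝ (Fin m) → ℝ} (h : IsWeakPartialDeriv Ω i u g)
    (hW : W ⊆ Ω) (hu : W.indicator u =ᵐ[volume] u') (hg : W.indicator g =ᵐ[volume] g')
    {φ : EuclideanSpace ℝ (Fin m) → ℝ} (hφ : ContDiff ℝ ∞ φ) (hφc : HasCompactSupport φ)
    (hφW : tsupport φ ⊆ W) :
    ∫ x, u' x * fderiv ℝ φ x (EuclideanSpace.single i 1) = - ∫ x, g' x * φ x := by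
  have hd : ∀ x, x ∉ W → fderiv ℝ φ x (EuclideanSpace.single i 1) = 0 := by
    intro x hx
    rw [fderiv_of_notMem_tsupport (𝕜 := ℝ) fun hx' => hx (hφW hx')]
    rfl
  have hz : ∀ x, x ∉ W → φ x = 0 := fun x hx => image_eq_zero_of_notMem_tsupport
    fun hx' => hx (hφW hx')
  have key : ∀ {w w' ψ : EuclideanSpace ℝ (Fin m) → ℝ}, W.indicator w =ᵐ[volume] w' →
      (∀ x, x ∉ W → ψ x = 0) → ∫ x, w' x * ψ x = ∫ x in Ω, w x * ψ x := by
    intro w w' ψ hw hψ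
    rw [setIntegral_eq_integral_of_forall_compl_eq_zero fun x hx => by
      rw [hψ x fun hx' => hx (hW hx'), mul_zero]]
    refine integral_congr_ae ?_
    filter_upwards [hw] with x hx
    rw [← hx]
    by_cases hxW : x ∈ W
    · rw [Set.indicator_of_mem hxW]
    · rw [hψ x hxW, mul_zero, mul_zero]
  rw [key hu hd, key hg hz]
  exact h.2 φ hφ hφc (hφW.trans hW)

/-- The rank estimate on an open set that is relatively compact in the domain. -/
lemma ae_rank_le_of_subset_isCompact {m n : ℕ} {Ω W C : Set (EuclideanSpace ℝ (Fin m))}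
    {f : EuclideanSpace ℝ (Fin m) → EuclideanSpace ℝ (Fin (2 * n + 1))}
    {Df : EuclideanSpace ℝ (Fin m) → Matrix (Fin (2 * n + 1)) (Fin m) ℝ}
    (hf : LocallyIntegrableOn f Ω volume) (hDf : IsWeakJacobian Ω f Df)
    (hcontact : ∀ᵐ x, x ∈ Ω → ContactEquation (f x) (Df x))
    (hW : IsOpen W) (hC : IsCompact C) (hWC : W ⊆ C) (hCΩ : C ⊆ Ω) :
    ∀ᵐ x, x ∈ W → (Df x).rank ≤ n := by
  have hWΩ := hWC.trans hCΩ
  have hF : ∀ k, Integrable (W.indicator fun x => f x k) volume := fun k => by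
    rw [integrable_indicator_iff hW.measurableSet]
    exact (EuclideanSpace.proj (𝕜 := ℝ) k).integrable_comp
      ((hf.integrableOn_compact_subset hCΩ hC).mono_set hWC)
  have hG : ∀ k i, Integrable (W.indicator fun x => Df x k i) volume := fun k i => by
    rw [integrable_indicator_iff hW.measurableSet]
    exact ((hDf k i).1.integrableOn_compact_subset hCΩ hC).mono_set hWC
  -- The truncations to `W` are replaced by measurable versions, as required for exchanging a.e.
  -- quantifiers on segments. Neither the weak formula on `W` nor the a.e. contact equation is
  -- affected.
  have hFe := fun k => (hF k).aestronglyMeasurable.ae_eq_mk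
  have hGe := fun k i => (hG k i).aestronglyMeasurable.ae_eq_mk
  have hFa := ae_all_iff.mpr hFe
  have hGa := ae_all_iff.mpr fun k => ae_all_iff.mpr (hGe k)
  have hiso := ae_symplectic_eq_zero_of_contact volume
    (a := contactFst) (b := contactSnd) (c := Fin.last (2 * n))
    (e := fun i => EuclideanSpace.single i (1 : ℝ)) (by simp) hW
    (fun k => (hF k).congr (hFe k))
    (fun k => (hF k).aestronglyMeasurable.stronglyMeasurable_mk.measurable)
    (fun k i => (hG k i).congr (hGe k i))
    (fun k i => (hG k i).aestronglyMeasurable.stronglyMeasurable_mk.measurable)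
    (fun k i φ h1 h2 h3 => (hDf k i).integral_mul_fderiv hWΩ (hFe k) (hGe k i) h1 h2 h3) (by
      filter_upwards [hFa, hGa, hcontact] with x h1 h2 h3 hx i
      simp only [← h1, ← h2, Set.indicator_of_mem hx]
      have := congrFun (h3 (hWΩ hx)) i
      simpa [Finset.sum_apply] using this)
  filter_upwards [hFa, hGa, hcontact, hiso] with x h1 h2 h3 h4 hx
  refine (h3 (hWΩ hx)).rank_le fun p q => ?_
  have := h4 hx p q
  simpa only [← h2, Set.indicator_of_mem hx] using this

theorem mainTheorem3 (m n : ℕ) (Ω : Set (EuclideanSpace ℝ (Fin m))) (hΩ : IsOpen Ω)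
    (f : EuclideanSpace ℝ (Fin m) → EuclideanSpace ℝ (Fin (2 * n + 1)))
    (hf : MemSobolevW11loc Ω f)
    (Df : EuclideanSpace ℝ (Fin m) → Matrix (Fin (2 * n + 1)) (Fin m) ℝ)
    (hDf : IsWeakJacobian Ω f Df)
    (hcontact : ∀ᵐ x ∂(volume.restrict Ω), ContactEquation (f x) (Df x)) :
    ∀ᵐ x ∂(volume.restrict Ω), (Df x).rank ≤ n := by
  rw [ae_restrict_iff' hΩ.measurableSet] at hcontact ⊢
  rw [ae_iff]
  -- The exceptional set lies in `Ω`, so nullity need only be checked on a ball around each point of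
  -- `Ω` whose closure is compact in `Ω`.
  refine measure_null_of_locally_null _ fun x hx => ?_
  have hxΩ : x ∈ Ω := by
    by_contra h
    exact hx fun h' => absurd h' h
  obtain ⟨ρ, hρ, hρΩ⟩ := Metric.nhds_basis_closedBall.mem_iff.mp (hΩ.mem_nhds hxΩ)
  have h := ae_rank_le_of_subset_isCompact hf.1 hDf hcontact Metric.isOpen_ball
    (isCompact_closedBall x ρ) Metric.ball_subset_closedBall hρΩ
  refine ⟨_, Filter.inter_mem self_mem_nhdsWithin
    (mem_nhdsWithin_of_mem_nhds (Metric.ball_mem_nhds x hρ)), ?_⟩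
  refine measure_mono_null ?_ (ae_iff.mp h)
  rintro y ⟨hy, hyB⟩ hy'
  exact hy fun _ => hy' hyB
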